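/- Let $\Sigma_+=\{0,1\}^{\{0,1,2,\dots\}}$ be the space of one-sided sequences $\omega=(\omega_0,\omega_1,\dots)$, let $\sigma_+$ be the left shift on $\Sigma_+$, and let $\mu_+$ be the Bernoulli measure with probabilities $(1/2,1/2)$, that is, the product of the uniform measures on $\{0,1\}$. Let $0<c<1/2$, $a=\frac1{2(1-c)}$, $b=\frac1{2c}$, and let $f_0,f_1:[0,1]\to[0,1]$ be the piecewise linear homeomorphisms \[ f_0(x)=\begin{cases} ax & \text{if } 0\le x\le 1-c,\\ 1-b(1-x) & \text{if } 1-c\le x\le 1,\end{cases} \qquad f_1(x)=\begin{cases} bx & \text{if } 0\le x\le c,\\ 1-a(1-x) & \text{if } c\le x\le 1.\end{cases} \] Let $F_+:\Sigma_+\times[0,1]\to\Sigma_+\times[0,1]$ be the skew product $F_+(\omega,x)=(\sigma_+(\omega),f_{\omega_0}(x))$, and for $\omega\in\Sigma_+$ and $x_0\in[0,1]$ let $x_n$ be the second coordinate of $F_+^n(\omega,x_0)$. Then there is no measurable (even with respect to the $\mu_+$-completion of the product $\sigma$-algebra) function $\varphi_+:\Sigma_+\to(0,1)$ whose graph is an attractor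 for $F_+$ in the sense that for $\mu_+$-almost every $\omega\in\Sigma_+$ and every $x_0\in(0,1)$ we have \[ \lim_{n\to\infty}\bigl|x_n-\varphi_+(\sigma_+^n(\omega))\bigr|=0 . \] -/

import Mathlib

open MeasureTheory Filter Topology

/-- The one-sided full shift space on two symbols: sequences `ω = (ω₀, ω₁, …)` in `{0,1}`,
with the product `σ`-algebra. -/
abbrev SigmaPlus : Type := ℕ → Fin 2

/-- The left shift `σ₊` on one-sided sequences. -/
def shiftPlus (ω : SigmaPlus) : SigmaPlus := fun n => ω (n + 1)

/-- The Bernoulli measure with probabilities `(1/2, 1/2)`: the infinite product of the uniform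
probability measure on `{0,1}`. -/
noncomputable def muPlus : Measure SigmaPlus :=
  Measure.infinitePi (fun _ : ℕ => (PMF.uniformOfFintype (Fin 2)).toMeasure)

/-- The slope `a = 1 / (2 (1 - c))`. -/
noncomputable def slopeA (c : ℝ) : ℝ := 1 / (2 * (1 - c))

/-- The slope `b = 1 / (2 c)`. -/
noncomputable def slopeB (c : ℝ) : ℝ := 1 / (2 * c)

/-- The formula of the map `f₀`, with break point `1 - c`. -/
noncomputable def f0 (c x : ℝ) : ℝ :=
  if x ≤ 1 - c then slopeA c * x else 1 - slopeB c * (1 - x)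

/-- The formula of the map `f₁`, with break point `c`. -/
noncomputable def f1 (c x : ℝ) : ℝ :=
  if x ≤ c then slopeB c * x else 1 - slopeA c * (1 - x)

theorem f1_eq_symm {c : ℝ} (hc : c ∈ Set.Ioo (0 : ℝ) (1 / 2)) (x : ℝ) :
    f1 c x = 1 - f0 c (1 - x) := by
  obtain ⟨h0, h1⟩ := hc
  have hne : (1 - c) ≠ 0 := by linarith
  unfold f0 f1 slopeA slopeB
  rcases lt_trichotomy x c with h | h | h
  · rw [if_pos h.le, if_neg (by linarith)]; ring
  · subst h
    rw [if_pos le_rfl, if_pos le_rfl]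
    field_simp
    ring
  · rw [if_neg (by linarith), if_pos (by linarith)]

theorem f0_mem {c : ℝ} (hc : c ∈ Set.Ioo (0 : ℝ) (1 / 2)) {x : ℝ}
    (hx : x ∈ Set.Icc (0 : ℝ) 1) : f0 c x ∈ Set.Icc (0 : ℝ) 1 := by
  obtain ⟨h0, h1⟩ := hc
  obtain ⟨hx0, hx1⟩ := hx
  have hp : 0 < 2 * (1 - c) := by linarith
  have hq : 0 < 2 * c := by linarith
  unfold f0 slopeA slopeB
  split_ifs with h
  · rw [one_div_mul_eq_div]
    exact ⟨div_nonneg hx0 hp.le, (div_le_one hp).2 (by linarith)⟩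
  · rw [one_div_mul_eq_div]
    have e1 : 0 ≤ (1 - x) / (2 * c) := div_nonneg (by linarith) hq.le
    have e2 : (1 - x) / (2 * c) ≤ 1 := (div_le_one hq).2 (by linarith)
    exact ⟨by linarith, by linarith⟩

theorem f1_mem {c : ℝ} (hc : c ∈ Set.Ioo (0 : ℝ) (1 / 2)) {x : ℝ}
    (hx : x ∈ Set.Icc (0 : ℝ) 1) : f1 c x ∈ Set.Icc (0 : ℝ) 1 := by
  have h := f0_mem hc (x := 1 - x) ⟨by linarith [hx.2], by linarith [hx.1]⟩
  rw [f1_eq_symm hc]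
  exact ⟨by linarith [h.2], by linarith [h.1]⟩

/-- The fibre map `f_j : I → I` of the unit interval, for `j ∈ {0,1}`. -/
noncomputable def fiberMap (c : ℝ) (hc : c ∈ Set.Ioo (0 : ℝ) (1 / 2)) (j : Fin 2)
    (x : unitInterval) : unitInterval :=
  if j = 0 then ⟨f0 c x, f0_mem hc x.2⟩ else ⟨f1 c x, f1_mem hc x.2⟩

/-- The skew product `F₊ (ω, x) = (σ₊ ω, f_{ω₀} x)` on `Σ₊ × I`. -/
noncomputable def FPlus (c : ℝ) (hc : c ∈ Set.Ioo (0 : ℝ) (1 / 2))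
    (p : SigmaPlus × unitInterval) : SigmaPlus × unitInterval :=
  (shiftPlus p.1, fiberMap c hc (p.1 0) p.2)

/-! The inverse branches of `f₀` and `f₁` average to the identity, so Lebesgue measure is stationary
and `muPlus.prod volume` is invariant under `FPlus` (`measurePreserving_FPlus`). If the graph of `φ`
attracted, the bounded function `|x - φ ω|` would tend to `0` along almost every orbit; its integral
is constant along the dynamics, hence zero by dominated convergence. Then for almost every `ω`,
almost every `x` would equal `φ ω`, which is absurd since Lebesgue measure has no atoms. -/

instance isProbabilityMeasure_muPlus : IsProbabilityMeasure muPlus := by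
  unfold muPlus; infer_instance

/-- Prepending a symbol to a one-sided sequence. -/
def consPlus (p : Fin 2 × SigmaPlus) : SigmaPlus
  | 0 => p.1
  | n + 1 => p.2 n

theorem measurable_consPlus : Measurable consPlus := by
  refine measurable_pi_lambda _ fun n => ?_
  cases n with
  | zero => exact measurable_fst
  | succ n => exact (measurable_pi_apply n).comp measurable_snd

theorem measurable_shiftPlus : Measurable shiftPlus :=
  measurable_pi_lambda _ fun n => measurable_pi_apply (n + 1)

theorem measurePreserving_consPlus :
    MeasurePreserving consPlus ((PMF.uniformOfFintype (Fin 2)).toMeasure.prod muPlus) muPlus := by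
  classical
  refine ⟨measurable_consPlus, Measure.eq_infinitePi _ fun s t ht => ?_⟩
  obtain ⟨N, hN⟩ := s.exists_nat_subset_range
  -- Padding with `univ` turns the cylinder into one over an initial segment, where the coordinate
  -- `0` splits off.
  set u : ℕ → Set (Fin 2) := fun i => if i ∈ s then t i else Set.univ with hu
  have hum : ∀ i, MeasurableSet (u i) := fun i => (u i).toFinite.measurableSet
  have hpre : consPlus ⁻¹' (Set.pi s t) =
      u 0 ×ˢ Set.pi (Finset.range N : Set ℕ) (fun i => u (i + 1)) := by
    ext p
    simp only [Set.mem_preimage, Set.mem_pi, Set.mem_prod, hu, Finset.mem_coe, Finset.mem_range]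
    constructor
    · intro h
      refine ⟨?_, fun i _ => ?_⟩
      · split_ifs with h0
        exacts [h 0 h0, trivial]
      · split_ifs with h0
        exacts [h (i + 1) h0, trivial]
    · rintro ⟨h0, h1⟩ i hi
      cases i with
      | zero => simpa [hi, consPlus] using h0
      | succ i =>
        have := h1 i (by have := Finset.mem_range.1 (hN hi); omega)
        simpa [hi, consPlus] using this
  have hprod : ∏ i ∈ s, (PMF.uniformOfFintype (Fin 2)).toMeasure (t i) =
      ∏ i ∈ Finset.range (N + 1), (PMF.uniformOfFintype (Fin 2)).toMeasure (u i) := by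
    have hs : s ⊆ Finset.range (N + 1) :=
      hN.trans (Finset.range_subset_range.2 (Nat.le_succ N))
    rw [← Finset.prod_subset hs]
    · exact Finset.prod_congr rfl fun i hi => by simp [hu, hi]
    · intro i _ hi
      simp only [hu, hi, if_false]
      exact measure_univ
  rw [Measure.map_apply measurable_consPlus
    (.pi s.countable_toSet fun i _ => ht i), hpre, Measure.prod_prod, hprod,
    Finset.prod_range_succ', muPlus, Measure.infinitePi_pi _ fun i _ => hum (i + 1), mul_comm]

/-- The formula of the inverse of the fibre map `f_j`. -/
noncomputable def fiberInv (c : ℝ) (j : Fin 2) (y : ℝ) : ℝ :=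
  if j = 0 then (if y ≤ 1 / 2 then 2 * (1 - c) * y else 1 - 2 * c * (1 - y))
  else (if y ≤ 1 / 2 then 2 * c * y else 1 - 2 * (1 - c) * (1 - y))

theorem fiberInv_mem {c : ℝ} (hc : c ∈ Set.Ioo (0 : ℝ) (1 / 2)) (j : Fin 2) {y : ℝ}
    (hy : y ∈ Set.Icc (0 : ℝ) 1) : fiberInv c j y ∈ Set.Icc (0 : ℝ) 1 := by
  obtain ⟨h0, h1⟩ := hc
  obtain ⟨hy0, hy1⟩ := hy
  unfold fiberInv
  split_ifs <;> constructor <;> nlinarith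

/-- This adjunction form gives the preimages of `Iic` directly, and with them both measurability and
distribution functions. -/
theorem f0_le_iff {c : ℝ} (hc : c ∈ Set.Ioo (0 : ℝ) (1 / 2)) (x y : ℝ) :
    f0 c x ≤ y ↔ x ≤ fiberInv c 0 y := by
  obtain ⟨h0, h1⟩ := hc
  have hp : 0 < 2 * (1 - c) := by linarith
  have hq : 0 < 2 * c := by linarith
  simp only [f0, slopeA, slopeB, fiberInv, one_div_mul_eq_div, if_true]
  split_ifs with hx hy hy
  · rw [div_le_iff₀ hp, mul_comm]
  · rw [div_le_iff₀ hp]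
    constructor <;> intro <;> nlinarith
  · rw [sub_le_comm, le_div_iff₀ hq]
    constructor <;> intro <;> nlinarith
  · rw [sub_le_comm, le_div_iff₀ hq]
    constructor <;> intro <;> linarith

theorem f1_le_iff {c : ℝ} (hc : c ∈ Set.Ioo (0 : ℝ) (1 / 2)) (x y : ℝ) :
    f1 c x ≤ y ↔ x ≤ fiberInv c 1 y := by
  obtain ⟨h0, h1⟩ := hc
  have hp : 0 < 2 * (1 - c) := by linarith
  have hq : 0 < 2 * c := by linarith
  simp only [f1, slopeA, slopeB, fiberInv, one_div_mul_eq_div, one_ne_zero, if_false]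
  split_ifs with hx hy hy
  · rw [div_le_iff₀ hq, mul_comm]
  · rw [div_le_iff₀ hq]
    constructor <;> intro <;> nlinarith
  · rw [sub_le_comm, le_div_iff₀ hp]
    constructor <;> intro <;> nlinarith
  · rw [sub_le_comm, le_div_iff₀ hp]
    constructor <;> intro <;> linarith

theorem fiberMap_le_iff {c : ℝ} (hc : c ∈ Set.Ioo (0 : ℝ) (1 / 2)) (j : Fin 2)
    (x y : unitInterval) :
    fiberMap c hc j x ≤ y ↔ x ≤ ⟨fiberInv c j y, fiberInv_mem hc j y.2⟩ := by
  rw [← Subtype.coe_le_coe, ← Subtype.coe_le_coe]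
  match j with
  | 0 => simpa [fiberMap] using f0_le_iff hc x y
  | 1 => simpa [fiberMap] using f1_le_iff hc x y

/-- The cancellation behind stationarity: the preimages of `[0, y]` have average length `y`. -/
theorem fiberInv_zero_add_one (c y : ℝ) : fiberInv c 0 y + fiberInv c 1 y = 2 * y := by
  simp only [fiberInv, if_true, one_ne_zero, if_false]
  split_ifs <;> ring

theorem preimage_fiberMap_Iic {c : ℝ} (hc : c ∈ Set.Ioo (0 : ℝ) (1 / 2)) (j : Fin 2)
    (y : unitInterval) :
    fiberMap c hc j ⁻¹' Set.Iic y = Set.Iic ⟨fiberInv c j y, fiberInv_mem hc j y.2⟩ :=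
  Set.ext fun x => fiberMap_le_iff hc j x y

theorem measurable_fiberMap {c : ℝ} (hc : c ∈ Set.Ioo (0 : ℝ) (1 / 2)) (j : Fin 2) :
    Measurable (fiberMap c hc j) :=
  measurable_of_Iic fun y => by
    rw [preimage_fiberMap_Iic]
    exact measurableSet_Iic

/-- Lebesgue measure is stationary for the random walk that applies `f₀` and `f₁` with
probability `1/2` each. -/
theorem measurePreserving_fiberMap {c : ℝ} (hc : c ∈ Set.Ioo (0 : ℝ) (1 / 2)) :
    MeasurePreserving (fun p : Fin 2 × unitInterval => fiberMap c hc p.1 p.2)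
      ((PMF.uniformOfFintype (Fin 2)).toMeasure.prod volume) volume := by
  have hm : Measurable (fun p : Fin 2 × unitInterval => fiberMap c hc p.1 p.2) :=
    measurable_from_prod_countable_right fun j => measurable_fiberMap hc j
  have : IsProbabilityMeasure (Measure.map (fun p : Fin 2 × unitInterval => fiberMap c hc p.1 p.2)
      ((PMF.uniformOfFintype (Fin 2)).toMeasure.prod volume)) :=
    Measure.isProbabilityMeasure_map hm.aemeasurable
  refine ⟨hm, Measure.ext_of_Iic _ _ fun y => ?_⟩
  rw [Measure.map_apply hm measurableSet_Iic, Measure.prod_apply (hm measurableSet_Iic),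
    lintegral_fintype, Fin.sum_univ_two]
  have hsec : ∀ j : Fin 2, volume (Prod.mk j ⁻¹' ((fun p : Fin 2 × unitInterval =>
      fiberMap c hc p.1 p.2) ⁻¹' Set.Iic y)) = ENNReal.ofReal (fiberInv c j y) := fun j => by
    rw [← Set.preimage_comp]
    change volume (fiberMap c hc j ⁻¹' Set.Iic y) = _
    rw [preimage_fiberMap_Iic, unitInterval.volume_Iic]
  have hmass : ∀ j : Fin 2, (PMF.uniformOfFintype (Fin 2)).toMeasure {j} = 2⁻¹ := fun j => by
    rw [PMF.toMeasure_apply_singleton _ _ (measurableSet_singleton j)]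
    simp
  rw [hsec, hsec, hmass, hmass, ← add_mul, ← ENNReal.ofReal_add (fiberInv_mem hc 0 y.2).1
    (fiberInv_mem hc 1 y.2).1, fiberInv_zero_add_one, unitInterval.volume_Iic,
    ENNReal.ofReal_mul zero_le_two, ENNReal.ofReal_ofNat, mul_right_comm,
    ENNReal.mul_inv_cancel two_ne_zero ENNReal.ofNat_ne_top, one_mul]

theorem measurable_FPlus {c : ℝ} (hc : c ∈ Set.Ioo (0 : ℝ) (1 / 2)) : Measurable (FPlus c hc) :=
  (measurable_shiftPlus.comp measurable_fst).prodMk <|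
    (measurePreserving_fiberMap hc).measurable.comp
      (g := fun p : Fin 2 × unitInterval => fiberMap c hc p.1 p.2)
      (f := fun a : SigmaPlus × unitInterval => (a.1 0, a.2)) <|
      ((measurable_pi_apply 0).comp measurable_fst).prodMk measurable_snd

/-- Applied with `f` built from `consPlus`, after which the shift becomes a projection. -/
theorem MeasureTheory.MeasurePreserving.of_comp {α β γ : Type*} [MeasurableSpace α]
    [MeasurableSpace β] [MeasurableSpace γ] {μ : Measure α} {ν : Measure β} {ρ : Measure γ}
    {f : α → β} {g : β → γ} (hf : MeasurePreserving f μ ν) (hgf : MeasurePreserving (g ∘ f) μ ρ)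
    (hg : Measurable g) : MeasurePreserving g ν ρ :=
  ⟨hg, by rw [← hf.map_eq, Measure.map_map hg hf.measurable, hgf.map_eq]⟩

/-- The product of the Bernoulli measure and Lebesgue measure is invariant under `F₊`. -/
theorem measurePreserving_FPlus {c : ℝ} (hc : c ∈ Set.Ioo (0 : ℝ) (1 / 2)) :
    MeasurePreserving (FPlus c hc) (muPlus.prod volume) (muPlus.prod volume) := by
  have hcons := measurePreserving_consPlus.prod (MeasurePreserving.id (volume : Measure unitInterval))
  refine MeasurePreserving.of_comp hcons ?_ (measurable_FPlus hc)
  -- The composite is `((j, ω), x) ↦ ((ω, j), x) ↦ (ω, (j, x)) ↦ (ω, f_j x)`.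
  exact ((MeasurePreserving.id muPlus).prod (measurePreserving_fiberMap hc)).comp <|
    (measurePreserving_prodAssoc _ _ _).comp <|
      Measure.measurePreserving_swap.prod (MeasurePreserving.id _)

theorem measurePreserving_shiftPlus : MeasurePreserving shiftPlus muPlus muPlus :=
  MeasurePreserving.of_comp measurePreserving_consPlus measurePreserving_snd measurable_shiftPlus

theorem fst_iterate_FPlus {c : ℝ} (hc : c ∈ Set.Ioo (0 : ℝ) (1 / 2)) (n : ℕ)
    (p : SigmaPlus × unitInterval) : ((FPlus c hc)^[n] p).1 = shiftPlus^[n] p.1 :=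
  (Function.Semiconj.iterate_right (f := Prod.fst) (ga := FPlus c hc) (gb := shiftPlus)
    (fun _ => rfl) n) p

/-- A bounded function which tends to zero along almost every orbit of a map preserving a
finite measure vanishes almost everywhere. -/
theorem MeasureTheory.MeasurePreserving.ae_eq_zero_of_tendsto_iterate {α : Type*}
    [MeasurableSpace α] {μ : Measure α} [IsFiniteMeasure μ] {T : α → α}
    (hT : MeasurePreserving T μ μ) {g : α → ℝ} (hg : Measurable g) (hg0 : ∀ x, 0 ≤ g x) {C : ℝ}
    (hgC : ∀ x, g x ≤ C) (hlim : ∀ᵐ x ∂μ, Tendsto (fun n => g (T^[n] x)) atTop (𝓝 0)) :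
    g =ᵐ[μ] 0 := by
  have hint : Integrable g μ := Integrable.of_bound hg.aestronglyMeasurable C
    (ae_of_all _ fun x => by rw [Real.norm_of_nonneg (hg0 x)]; exact hgC x)
  have key := tendsto_integral_of_dominated_convergence (fun _ => C)
    (fun n => (hg.comp (hT.iterate n).measurable).aestronglyMeasurable) (integrable_const C)
    (fun n => ae_of_all μ fun x => by
      rw [Function.comp_apply, Real.norm_of_nonneg (hg0 _)]; exact hgC _) hlim
  have hconst : ∀ n, ∫ x, (g ∘ T^[n]) x ∂μ = ∫ x, g x ∂μ := fun n => by
    conv_rhs => rw [← (hT.iterate n).map_eq]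
    exact (integral_map (hT.iterate n).aemeasurable hg.aestronglyMeasurable).symm
  simp only [hconst, integral_zero] at key
  exact (integral_eq_zero_iff_of_nonneg hg0 hint).1 (tendsto_nhds_unique tendsto_const_nhds key)

theorem theorem7p1 (c : ℝ) (hc : c ∈ Set.Ioo (0 : ℝ) (1 / 2)) :
    ¬ ∃ φ : SigmaPlus → Set.Ioo (0 : ℝ) 1, NullMeasurable φ muPlus ∧
      ∀ᵐ ω ∂muPlus, ∀ x₀ : unitInterval, (x₀ : ℝ) ∈ Set.Ioo (0 : ℝ) 1 →
        Tendsto (fun n : ℕ =>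
            |(((FPlus c hc)^[n] (ω, x₀)).2 : ℝ) - (φ (shiftPlus^[n] ω) : ℝ)|)
          atTop (𝓝 0) := by
  rintro ⟨φ, hφ, hattr⟩
  obtain ⟨ψ, hψ, hφψ⟩ := hφ.aemeasurable
  -- Shift invariance lets the measurable version `ψ` replace `φ` along the whole orbit.
  have horb : ∀ᵐ ω ∂muPlus, ∀ n, φ (shiftPlus^[n] ω) = ψ (shiftPlus^[n] ω) :=
    ae_all_iff.2 fun n =>
      (measurePreserving_shiftPlus.iterate n).quasiMeasurePreserving.ae hφψ
  have hinterior : ∀ᵐ x : unitInterval, (x : ℝ) ∈ Set.Ioo (0 : ℝ) 1 := by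
    filter_upwards [measure_eq_zero_iff_ae_notMem.1 (measure_singleton (μ := volume) (0 : unitInterval)),
      measure_eq_zero_iff_ae_notMem.1 (measure_singleton (μ := volume) (1 : unitInterval))]
      with x h0 h1
    exact ⟨unitInterval.pos_iff_ne_zero.2 h0, unitInterval.lt_one_iff_ne_one.2 h1⟩
  let g : SigmaPlus × unitInterval → ℝ := fun p => |(p.2 : ℝ) - (ψ p.1 : ℝ)|
  have hg : Measurable g :=
    ((measurable_subtype_coe.comp measurable_snd).sub
      (measurable_subtype_coe.comp (hψ.comp measurable_fst))).abs
  have hzero : g =ᵐ[muPlus.prod volume] 0 := by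
    refine (measurePreserving_FPlus hc).ae_eq_zero_of_tendsto_iterate hg
      (fun p => abs_nonneg _) (C := 1) (fun p => ?_) ?_
    · have h1 := p.2.2
      have h2 := (ψ p.1).2
      exact abs_le.2 ⟨by linarith [h1.1, h2.2], by linarith [h1.2, h2.1]⟩
    · filter_upwards [Measure.quasiMeasurePreserving_fst.ae hattr,
        Measure.quasiMeasurePreserving_fst.ae horb,
        Measure.quasiMeasurePreserving_snd.ae hinterior] with p h1 h2 h3
      refine (h1 p.2 h3).congr fun n => ?_
      simp only [g, fst_iterate_FPlus, h2 n]
  -- A single fibre on which almost every `x` equals `ψ ω` suffices.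
  obtain ⟨ω, hω⟩ := (Measure.ae_ae_of_ae_prod hzero).exists
  have hne : ∀ᵐ x : unitInterval, x ≠ ⟨ψ ω, Set.Ioo_subset_Icc_self (ψ ω).2⟩ :=
    measure_eq_zero_iff_ae_notMem.1 (measure_singleton _)
  obtain ⟨x, hx, hx'⟩ := (hω.and hne).exists
  exact hx' (Subtype.ext (sub_eq_zero.1 (abs_eq_zero.1 hx)))
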